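/- Let $\mathcal C$ be a triangulated category with a weight structure $w$ in the homological convention: $\mathcal C_{w\le 0},\mathcal C_{w\ge 0}$ are classes of objects closed under retracts in $\mathcal C$, with $\mathcal C_{w\le 0}\subset \mathcal C_{w\le 0}[1]$, $\mathcal C_{w\ge 0}[1]\subset \mathcal C_{w\ge 0}$, $\mathcal C(X,Y[1])=0$ for $X\in\mathcal C_{w\le 0}$, $Y\in\mathcal C_{w\ge 0}$, and such that every object $M$ lies in a distinguished triangle $X\to M\to Y[1]\to X[1]$ with $X\in\mathcal C_{w\le 0}$, $Y\in\mathcal C_{w\ge 0}$. Put $\mathcal C_{w\le n}=\mathcal C_{w\le 0}[n]$ and $\mathcal C_{w\ge n}=\mathcal C_{w\ge 0}[n]$. The heart $\underline{Hw}$ is the full subcategory with objects $\mathcal C_{w\le 0}\cap\mathcal C_{w\ge 0}$, and $\mathcal C^b$ is the full subcategory with objects $\bigcup_{i,j}(\mathcal C_{w\ge i}\cap \mathcal C_{w\le j})$. Say that $w$ restricts to a full triangulated subcategory $\mathcal E$ if the classes $\mathrm{Obj}\,\mathcal E\cap \mathcal C_{w\le 0}$ and $\mathrm{Obj}\,\mathcal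 E\cap\mathcal C_{w\ge 0}$ form a weight structure on $\mathcal E$. Objects of $\bigcap_{n\in\mathbb Z}\mathcal C_{w\le n}$ (resp. of $\bigcap_{n\in\mathbb Z}\mathcal C_{w\ge n}$) are called right (resp. left) degenerate. 1. The full subcategory of right degenerate objects and the full subcategory of left degenerate objects are triangulated; $w$ restricts to each of them and to all full triangulated subcategories of each of them. 2. Let $G_-$ be a set of right degenerate objects and $G_+$ a set of left degenerate objects. Let $\mathcal D$, $\mathcal D_-$, $\mathcal D_+$ be the smallest strictly full triangulated subcategories of $\mathcal C$ containing $G_-\cup G_+$, $G_-$, $G_+$, respectively. Then $w$ restricts to $\mathcal D$. Moreover, for every object $X$ of $\mathcal D$ there is a distinguished triangle $X_-\to X\to X_+\to X_-[1]$ with $X_-\in\mathcal D_-$ and $X_+\in\mathcal D_+$. 3. Let $L:\mathcal C\to\mathcal C/\mathcal D$ be the localization functor to the Verdier quotient. There exists a unique weight structure $w'$ on $\mathcal C/\mathcal D$ such that $L$ is weight-exact, i.e. $L(\mathcal C_{w\le 0})\subset(\mathcal C/\mathcal D)_{w'\le 0}$ and $L(\mathcal C_{w\ge 0})\subset(\mathcal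 C/\mathcal D)_{w'\ge 0}$. Its heart is the Karoubi-closure $\mathrm{Kar}_{\mathcal C/\mathcal D}(\underline{Hw})$, i.e. the full subcategory of $\mathcal C/\mathcal D$ whose objects are all retracts of objects $L(H)$ with $H\in\underline{Hw}$. 4. For all $X,Y\in\mathcal C^b$ the map $\mathcal C(X,Y)\to(\mathcal C/\mathcal D)(L(X),L(Y))$ is bijective. -/

import Mathlib

universe v u v' u'

open CategoryTheory CategoryTheory.Limits CategoryTheory.Pretriangulated

namespace WeightStr

section

variable {C : Type u} [Category.{v} C] [HasZeroObject C] [Preadditive C] [HasShift C ℤ]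
  [∀ n : ℤ, (shiftFunctor C n).Additive] [Pretriangulated C]

/-- A pair of classes of objects `nonpos` (written `C_{w ≤ 0}`) and `nonneg` (written
`C_{w ≥ 0}`) of a triangulated category defines a weight structure (homological convention). -/
structure IsWeightStructure (nonpos nonneg : ObjectProperty C) : Prop where
  /-- `C_{w ≤ 0}` contains all retracts of its elements. -/
  nonpos_retract : nonpos.IsStableUnderRetracts
  /-- `C_{w ≥ 0}` contains all retracts of its elements. -/
  nonneg_retract : nonneg.IsStableUnderRetracts
  /-- `C_{w ≤ 0} ⊆ C_{w ≤ 0}[1]`. -/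
  nonpos_shift : ∀ X : C, nonpos X → nonpos (X⟦(-1 : ℤ)⟧)
  /-- `C_{w ≥ 0}[1] ⊆ C_{w ≥ 0}`. -/
  nonneg_shift : ∀ X : C, nonneg X → nonneg (X⟦(1 : ℤ)⟧)
  /-- Orthogonality: there are no nonzero morphisms from `C_{w ≤ 0}` to `C_{w ≥ 0}[1]`. -/
  orthogonal : ∀ X Y : C, nonpos X → nonneg Y → ∀ f : X ⟶ Y⟦(1 : ℤ)⟧, f = 0
  /-- Weight decompositions `X ⟶ M ⟶ Y[1] ⟶ X[1]`. -/
  exists_decomposition : ∀ M : C, ∃ (X Y : C) (f : X ⟶ M) (g : M ⟶ Y⟦(1 : ℤ)⟧)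
    (h : Y⟦(1 : ℤ)⟧ ⟶ X⟦(1 : ℤ)⟧),
    nonpos X ∧ nonneg Y ∧ Triangle.mk f g h ∈ distTriang C

variable (C) in
/-- A weight structure on a triangulated category. -/
@[ext]
structure WeightStructure where
  /-- The class `C_{w ≤ 0}`. -/
  nonpos : ObjectProperty C
  /-- The class `C_{w ≥ 0}`. -/
  nonneg : ObjectProperty C
  isWeightStructure : IsWeightStructure nonpos nonneg

namespace WeightStructure

variable (w : WeightStructure C)

/-- `C_{w ≤ n} = C_{w ≤ 0}[n]`, i.e. the class of objects `X` such that `X[-n]` lies in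
`C_{w ≤ 0}`. -/
def le (n : ℤ) : ObjectProperty C := w.nonpos.shift (-n)

/-- `C_{w ≥ n} = C_{w ≥ 0}[n]`, i.e. the class of objects `X` such that `X[-n]` lies in
`C_{w ≥ 0}`. -/
def ge (n : ℤ) : ObjectProperty C := w.nonneg.shift (-n)

/-- The objects of the heart: `C_{w = 0} = C_{w ≤ 0} ∩ C_{w ≥ 0}`. -/
def heart : ObjectProperty C := w.nonpos ⊓ w.nonneg

/-- The objects of `C^b`: the union of the classes `C_{[i,j]} = C_{w ≥ i} ∩ C_{w ≤ j}`. -/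
def bounded : ObjectProperty C := fun X => ∃ i j : ℤ, w.ge i X ∧ w.le j X

/-- Right degenerate objects: the intersection of all `C_{w ≤ n}`. -/
def rightDegenerate : ObjectProperty C := fun X => ∀ n : ℤ, w.le n X

/-- Left degenerate objects: the intersection of all `C_{w ≥ n}`. -/
def leftDegenerate : ObjectProperty C := fun X => ∀ n : ℤ, w.ge n X

/-- `w` restricts to the full triangulated subcategory of objects satisfying `P`: the classes
of objects of this subcategory that belong to `C_{w ≤ 0}` and to `C_{w ≥ 0}` define a weight
structure on it. -/
def RestrictsTo (P : ObjectProperty C) [P.IsTriangulated] : Prop :=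
  IsWeightStructure (w.nonpos.inverseImage P.ι) (w.nonneg.inverseImage P.ι)

/-- An exact (triangulated) functor `F` is weight-exact with respect to `w` and `w'`. -/
def IsWeightExact {D : Type u'} [Category.{v'} D] [HasZeroObject D] [Preadditive D]
    [HasShift D ℤ] [∀ n : ℤ, (shiftFunctor D n).Additive] [Pretriangulated D]
    (w' : WeightStructure D) (F : C ⥤ D) [F.CommShift ℤ] [F.IsTriangulated] : Prop :=
  (∀ X : C, w.nonpos X → w'.nonpos (F.obj X)) ∧ (∀ X : C, w.nonneg X → w'.nonneg (F.obj X))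

end WeightStructure

/-- The objects of the triangulated subcategory generated by a class `G` of objects, i.e. of the
smallest strictly full triangulated subcategory containing `G`
(not necessarily closed under retracts). -/
def triangulatedClosure (G : ObjectProperty C) : ObjectProperty C := fun X =>
  ∀ Q : ObjectProperty C, Q.IsTriangulated → Q.IsClosedUnderIsomorphisms → G ≤ Q → Q X

instance (G : ObjectProperty C) : (triangulatedClosure G).IsClosedUnderIsomorphisms where
  of_iso e hX Q hQ hQ' hG := Q.prop_of_iso e (hX Q hQ hQ' hG)

instance (G : ObjectProperty C) : (triangulatedClosure G).IsTriangulated where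
  exists_zero := ⟨_, isZero_zero C, fun Q _ _ _ => Q.prop_zero⟩
  isStableUnderShiftBy n :=
    { le_shift := fun X hX Q hQ hQ' hG => Q.le_shift n X (hX Q hQ hQ' hG) }
  toIsTriangulatedClosed₂ := .mk' fun T hT h₁ h₃ Q hQ hQ' hG =>
    Q.ext_of_isTriangulatedClosed₂ T hT (h₁ Q hQ hQ' hG) (h₃ Q hQ hQ' hG)

/-- The Verdier quotient of a triangulated category by the full triangulated subcategory of
objects satisfying `P`: the localization at the morphisms whose cone satisfies `P`. -/
abbrev VerdierQuotient (P : ObjectProperty C) : Type u := P.trW.Localization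

/-- The localization functor to the Verdier quotient. -/
abbrev verdierFunctor (P : ObjectProperty C) : C ⥤ VerdierQuotient P := P.trW.Q

end

end WeightStr

open WeightStr

namespace WeightStr

open scoped ZeroObject

section

variable {C : Type u} [Category.{v} C] [HasZeroObject C] [Preadditive C] [HasShift C ℤ]
  [∀ n : ℤ, (shiftFunctor C n).Additive] [Pretriangulated C]

/-! A right degenerate object has weights below every bound, so by orthogonality it has no nonzero
morphism to an object bounded below; dually, an object bounded above has no nonzero morphism to a
left degenerate one. In particular `D_-` is left orthogonal to `D_+`. Hence extensions in the wrong
order split, and the extensions of `D_+` by `D_-` already form a triangulated subcategory, which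
must contain `D` (`isTriangulated_extensionProduct`). The resulting triangles `X_- → X → X_+` are
weight decompositions inside `D`.

For `X` bounded above and `Y` bounded below, the same vanishing makes `C(X, Y) → (C/D)(L X, L Y)`
bijective: denominators ending at `X` can be refined to have cone in `D_-`, and `Y` does not see
such cones (`bijective_map_of_le_extensionProduct`). This yields full faithfulness on bounded
objects. Its surjectivity part also transports orthogonality to the quotient, so the retract
closures of the images of the two classes form a weight structure there (`map`), and it identifies
the heart (`heart_map`). -/

lemma exists_eq_mor₂_comp {X Y Z W : C} {f : X ⟶ Y} {g : Y ⟶ Z} {h : Z ⟶ X⟦(1 : ℤ)⟧}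
    (hT : Triangle.mk f g h ∈ distTriang C) (k : Y ⟶ W) (hk : f ≫ k = 0) :
    ∃ l : Z ⟶ W, k = g ≫ l :=
  Triangle.yoneda_exact₂ _ hT k hk

lemma exists_eq_comp_mor₁ {X Y Z W : C} {f : X ⟶ Y} {g : Y ⟶ Z} {h : Z ⟶ X⟦(1 : ℤ)⟧}
    (hT : Triangle.mk f g h ∈ distTriang C) (k : W ⟶ Y) (hk : k ≫ g = 0) :
    ∃ l : W ⟶ X, k = l ≫ f :=
  Triangle.coyoneda_exact₂ _ hT k hk

lemma mk_mem_distTriang_of_iso {X Y Z X' Y' Z' : C} {f : X ⟶ Y} {g : Y ⟶ Z}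
    {h : Z ⟶ X⟦(1 : ℤ)⟧} {f' : X' ⟶ Y'} {g' : Y' ⟶ Z'} {h' : Z' ⟶ X'⟦(1 : ℤ)⟧}
    (hT : Triangle.mk f g h ∈ distTriang C) (e₁ : X' ≅ X) (e₂ : Y' ≅ Y) (e₃ : Z' ≅ Z)
    (h₁ : f' ≫ e₂.hom = e₁.hom ≫ f) (h₂ : g' ≫ e₃.hom = e₂.hom ≫ g)
    (h₃ : h' ≫ e₁.hom⟦(1 : ℤ)⟧' = e₃.hom ≫ h) :
    Triangle.mk f' g' h' ∈ distTriang C :=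
  isomorphic_distinguished _ hT _ (Triangle.isoMk _ _ e₁ e₂ e₃ h₁ h₂ h₃)

/-! ### Morphisms in a Verdier quotient under orthogonality conditions. -/

/-- The morphism from `X` to the cone of `s` dies in the `Q`-part of that cone, so it lifts to the
`P`-part. The fibre of the lift maps to `X` with cone in `P`, and this map factors through `s`. -/
lemma exists_factorization_precomp_trW {P Q D : ObjectProperty C}
    (hD : D ≤ ObjectProperty.extensionProduct P Q) {X X' : C} (hX : Q.leftOrthogonal X)
    {s : X' ⟶ X} (hs : D.trW s) :
    ∃ (X'' : C) (t : X'' ⟶ X'), P.trW (t ≫ s) := by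
  obtain ⟨Z, g, h, hT, hZ⟩ := hs
  obtain ⟨Zm, Zp, i, p, δ, hT', hZm, hZp⟩ := hD _ hZ
  obtain ⟨g', hg' : g = g' ≫ i⟩ := exists_eq_comp_mor₁ hT' g (hX _ hZp)
  obtain ⟨X'', a, c, hT''⟩ := distinguished_cocone_triangle₁ g'
  have zero : a ≫ g' = 0 := comp_distTriang_mor_zero₁₂ _ hT''
  obtain ⟨t, ht : a = t ≫ s⟩ := exists_eq_comp_mor₁ hT a
    (show a ≫ g = 0 by rw [hg', ← Category.assoc, zero, zero_comp])
  exact ⟨X'', t, ht ▸ ⟨_, _, _, hT'', hZm⟩⟩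

lemma bijective_map_of_le_extensionProduct [CategoryTheory.IsTriangulated C]
    {P Q D : ObjectProperty C} [P.IsTriangulated] [D.IsTriangulated] (hPD : P ≤ D)
    (hD : D ≤ ObjectProperty.extensionProduct P Q) {X Y : C} (hX : Q.leftOrthogonal X)
    (hY : P.rightOrthogonal Y) {E : Type u'} [Category.{v'} E] (L : C ⥤ E)
    [L.IsLocalization D.trW] :
    Function.Bijective (fun f : X ⟶ Y => L.map f) := by
  rw [← ObjectProperty.isLocal_trW] at hY
  refine ⟨fun f₁ f₂ hf => ?_, fun g => ?_⟩
  · obtain ⟨X', s, hs, eq⟩ := (MorphismProperty.map_eq_iff_precomp L D.trW f₁ f₂).1 hf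
    obtain ⟨X'', t, ht⟩ := exists_factorization_precomp_trW hD hX hs
    exact (hY _ ht).1 (by simp [eq])
  · obtain ⟨φ, hφ⟩ := Localization.exists_rightFraction L D.trW g
    obtain ⟨X'', t, ht⟩ := exists_factorization_precomp_trW hD hX φ.hs
    -- The refined denominator `t ≫ φ.s` has cone in `P`, and `Y` is local for such morphisms, so
    -- the numerator extends along it.
    obtain ⟨α, hα : (t ≫ φ.s) ≫ α = t ≫ φ.f⟩ := (hY _ ht).2 (t ≫ φ.f)
    have := Localization.inverts L D.trW _ (ObjectProperty.trW_monotone hPD _ ht)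
    refine ⟨α, ?_⟩
    change L.map α = g
    rw [← cancel_epi (L.map (t ≫ φ.s)), ← L.map_comp, hα, hφ, L.map_comp, L.map_comp,
      Category.assoc, MorphismProperty.RightFraction.map_s_comp_map]

/-! ### Extensions of orthogonal triangulated subcategories. -/

/-- The connecting morphism goes from `P` to a shift of `Q`, so it vanishes and the triangle splits;
the two summands can then be exchanged. -/
lemma extensionProduct_le_swap {P Q : ObjectProperty C} [Q.IsStableUnderShift ℤ]
    (hPQ : P ≤ Q.leftOrthogonal) :
    ObjectProperty.extensionProduct Q P ≤ ObjectProperty.extensionProduct P Q := by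
  rintro X ⟨B, A, f, g, h, hT, hB, hA⟩
  have hh : h = 0 := hPQ _ hA _ (Q.le_shift 1 _ hB)
  obtain ⟨e, -, -⟩ := exists_iso_binaryBiproduct_of_distTriang _ hT hh
  exact ObjectProperty.prop_of_iso _ (biprod.braiding A B ≪≫ e.symm)
    ⟨_, _, _, _, _, binaryBiproductTriangle_distinguished A B, hA, hB⟩

/-- Writing `*` for the extension product, which is associative: `(P*Q)*(P*Q) = P*(Q*P)*Q ≤
P*(P*Q)*Q = (P*P)*(Q*Q) ≤ P*Q`. -/
lemma isTriangulated_extensionProduct [CategoryTheory.IsTriangulated C]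
    {P Q : ObjectProperty C} [P.IsTriangulated] [Q.IsTriangulated]
    [P.IsClosedUnderIsomorphisms] [Q.IsClosedUnderIsomorphisms]
    (hPQ : P ≤ Q.leftOrthogonal) : (ObjectProperty.extensionProduct P Q).IsTriangulated where
  exists_zero := ⟨0, isZero_zero C, ObjectProperty.le_extensionProduct_left _ _ P.prop_zero⟩
  toIsTriangulatedClosed₂ := .mk' fun T hT h₁ h₃ => by
    have h : ObjectProperty.extensionProduct (ObjectProperty.extensionProduct P Q)
        (ObjectProperty.extensionProduct P Q) ≤ ObjectProperty.extensionProduct P Q := by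
      rw [ObjectProperty.extensionProduct_assoc, ← ObjectProperty.extensionProduct_assoc Q P Q]
      refine (ObjectProperty.monotone_extensionProduct_right _
        (ObjectProperty.monotone_extensionProduct_left _ (extensionProduct_le_swap hPQ))).trans ?_
      rw [ObjectProperty.extensionProduct_assoc, ← ObjectProperty.extensionProduct_assoc]
      exact (ObjectProperty.monotone_extensionProduct_right _
        (ObjectProperty.extensionProduct_le_of_isTriangulatedClosed₂ le_rfl le_rfl)).trans
        (ObjectProperty.monotone_extensionProduct_left _
        (ObjectProperty.extensionProduct_le_of_isTriangulatedClosed₂ le_rfl le_rfl))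
    exact h _ ⟨_, _, _, _, _, hT, h₁, h₃⟩

lemma le_triangulatedClosure (G : ObjectProperty C) : G ≤ triangulatedClosure G :=
  fun X hX _ _ _ hG => hG X hX

lemma triangulatedClosure_le {G Q : ObjectProperty C} [Q.IsTriangulated]
    [Q.IsClosedUnderIsomorphisms] (h : G ≤ Q) : triangulatedClosure G ≤ Q :=
  fun _ hX => hX Q inferInstance inferInstance h

lemma triangulatedClosure_sup_le_extensionProduct [CategoryTheory.IsTriangulated C]
    {G H : ObjectProperty C}
    (hGH : triangulatedClosure G ≤ (triangulatedClosure H).leftOrthogonal) :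
    triangulatedClosure (G ⊔ H) ≤
      ObjectProperty.extensionProduct (triangulatedClosure G) (triangulatedClosure H) :=
  have := isTriangulated_extensionProduct hGH
  triangulatedClosure_le (sup_le
    ((le_triangulatedClosure G).trans (ObjectProperty.le_extensionProduct_left _))
    ((le_triangulatedClosure H).trans (ObjectProperty.le_extensionProduct_right _)))

/-! ### Orthogonality in a weight structure and degenerate objects. -/

namespace WeightStructure

variable (w : WeightStructure C)

instance : w.nonpos.IsStableUnderRetracts := w.isWeightStructure.nonpos_retract

instance : w.nonneg.IsStableUnderRetracts := w.isWeightStructure.nonneg_retract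

instance : w.nonpos.Nonempty := by
  obtain ⟨X, _, _, _, _, hX, -⟩ := w.isWeightStructure.exists_decomposition 0
  exact ⟨X, hX⟩

instance : w.nonneg.Nonempty := by
  obtain ⟨_, Y, _, _, _, _, hY, -⟩ := w.isWeightStructure.exists_decomposition 0
  exact ⟨Y, hY⟩

/-- Each class is the full orthogonal of the other: if the second map of a weight decomposition of
`X` vanishes, then `X` is a retract of the first vertex. Closure under extensions and uniqueness of
weight structures follow from this. -/
lemma nonpos_iff (X : C) :
    w.nonpos X ↔ ∀ Y : C, w.nonneg Y → ∀ f : X ⟶ Y⟦(1 : ℤ)⟧, f = 0 := by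
  refine ⟨fun hX Y hY f => w.isWeightStructure.orthogonal X Y hX hY f, fun h => ?_⟩
  obtain ⟨X', Y', f, g, δ, hX', hY', hT⟩ := w.isWeightStructure.exists_decomposition X
  obtain ⟨i, hi⟩ := exists_eq_comp_mor₁ hT (𝟙 X)
    (by rw [Category.id_comp]; exact h _ hY' g)
  exact w.nonpos.prop_of_retract ⟨i, f, hi.symm⟩ hX'

lemma nonneg_iff (Y : C) :
    w.nonneg Y ↔ ∀ X : C, w.nonpos X → ∀ f : X ⟶ Y⟦(1 : ℤ)⟧, f = 0 := by
  refine ⟨fun hY X hX f => w.isWeightStructure.orthogonal X Y hX hY f, fun h => ?_⟩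
  obtain ⟨X', Y', f, g, δ, hX', hY', hT⟩ :=
    w.isWeightStructure.exists_decomposition (Y⟦(1 : ℤ)⟧)
  obtain ⟨r, hr⟩ := exists_eq_mor₂_comp hT (𝟙 (Y⟦(1 : ℤ)⟧))
    (by rw [Category.comp_id]; exact h _ hX' f)
  refine w.nonneg.prop_of_retract ⟨(shiftFunctor C (1 : ℤ)).preimage g,
    (shiftFunctor C (1 : ℤ)).preimage r, (shiftFunctor C (1 : ℤ)).map_injective ?_⟩ hY'
  rw [Functor.map_comp, Functor.map_preimage, Functor.map_preimage]
  exact hr.symm.trans ((shiftFunctor C (1 : ℤ)).map_id Y).symm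

lemma nonpos_obj₂ (T : Triangle C) (hT : T ∈ distTriang C) (h₁ : w.nonpos T.obj₁)
    (h₃ : w.nonpos T.obj₃) : w.nonpos T.obj₂ := by
  rw [nonpos_iff] at *
  intro Y hY f
  obtain ⟨g, rfl⟩ := Triangle.yoneda_exact₂ _ hT f (h₁ _ hY _)
  rw [h₃ _ hY g, comp_zero]

lemma nonneg_obj₂ (T : Triangle C) (hT : T ∈ distTriang C) (h₁ : w.nonneg T.obj₁)
    (h₃ : w.nonneg T.obj₃) : w.nonneg T.obj₂ := by
  rw [nonneg_iff] at *
  intro X hX f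
  have hT' := Triangle.shift_distinguished _ hT 1
  obtain ⟨g, rfl⟩ := exists_eq_comp_mor₁ hT' f (h₃ _ hX _)
  rw [h₁ _ hX g, zero_comp]

instance (n : ℤ) : (w.le n).IsClosedUnderIsomorphisms :=
  inferInstanceAs (w.nonpos.shift (-n)).IsClosedUnderIsomorphisms

instance (n : ℤ) : (w.ge n).IsClosedUnderIsomorphisms :=
  inferInstanceAs (w.nonneg.shift (-n)).IsClosedUnderIsomorphisms

lemma le_zero : w.le 0 = w.nonpos := by simp [le]

lemma ge_zero : w.ge 0 = w.nonneg := by simp [ge]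

lemma le_shift_iff (X : C) (n k : ℤ) : w.le n (X⟦k⟧) ↔ w.le (n - k) X := by
  change (w.nonpos.shift (-n)).shift k X ↔ _
  rw [ObjectProperty.shift_shift _ k (-n) (-(n - k)) (by lia), le]

lemma ge_shift_iff (X : C) (n k : ℤ) : w.ge n (X⟦k⟧) ↔ w.ge (n - k) X := by
  change (w.nonneg.shift (-n)).shift k X ↔ _
  rw [ObjectProperty.shift_shift _ k (-n) (-(n - k)) (by lia), ge]

lemma eq_zero_of_le_of_ge {X Y : C} {n : ℤ} (hX : w.le n X) (hY : w.ge (n + 1) Y)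
    (f : X ⟶ Y) : f = 0 := by
  apply (shiftFunctor C (-n)).map_injective
  rw [Functor.map_zero, ← cancel_mono
    ((shiftFunctorAdd' C (-(n + 1)) 1 (-n) (by lia)).hom.app Y), zero_comp]
  exact w.isWeightStructure.orthogonal _ _ hX hY _

instance : w.rightDegenerate.IsClosedUnderIsomorphisms where
  of_iso e hX n := (w.le n).prop_of_iso e (hX n)

instance : w.leftDegenerate.IsClosedUnderIsomorphisms where
  of_iso e hX n := (w.ge n).prop_of_iso e (hX n)

instance : w.rightDegenerate.IsTriangulated where
  exists_zero := ⟨0, isZero_zero C, fun n =>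
    w.nonpos.prop_of_isZero ((shiftFunctor C (-n)).map_isZero (isZero_zero C))⟩
  isStableUnderShiftBy k := ⟨fun X hX n => (w.le_shift_iff X n k).2 (hX _)⟩
  toIsTriangulatedClosed₂ := .mk' fun _ hT h₁ h₃ n =>
    w.nonpos_obj₂ _ (Triangle.shift_distinguished _ hT (-n)) (h₁ n) (h₃ n)

instance : w.leftDegenerate.IsTriangulated where
  exists_zero := ⟨0, isZero_zero C, fun n =>
    w.nonneg.prop_of_isZero ((shiftFunctor C (-n)).map_isZero (isZero_zero C))⟩
  isStableUnderShiftBy k := ⟨fun X hX n => (w.ge_shift_iff X n k).2 (hX _)⟩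
  toIsTriangulatedClosed₂ := .mk' fun _ hT h₁ h₃ n =>
    w.nonneg_obj₂ _ (Triangle.shift_distinguished _ hT (-n)) (h₁ n) (h₃ n)

lemma rightDegenerate_le_nonpos : w.rightDegenerate ≤ w.nonpos :=
  fun _ hX => w.le_zero ▸ hX 0

lemma leftDegenerate_le_nonneg : w.leftDegenerate ≤ w.nonneg :=
  fun _ hX => w.ge_zero ▸ hX 0

lemma ge_le_rightOrthogonal (n : ℤ) : w.ge n ≤ w.rightDegenerate.rightOrthogonal :=
  -- Orthogonality needs weights differing by one; the degenerate source may be placed in weights at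
  -- most `n - 1`.
  fun Y hY _ f hX => w.eq_zero_of_le_of_ge (hX (n - 1)) (by simpa using hY) f

lemma le_le_leftOrthogonal (n : ℤ) : w.le n ≤ w.leftDegenerate.leftOrthogonal :=
  fun _ hX _ f hY => w.eq_zero_of_le_of_ge hX (hY (n + 1)) f

lemma rightDegenerate_le_leftOrthogonal : w.rightDegenerate ≤ w.leftDegenerate.leftOrthogonal :=
  fun X hX => w.le_le_leftOrthogonal 0 X (hX 0)

/-! ### Restriction to triangulated subcategories. -/

/-- A full subcategory inherits every axiom except the existence of decompositions, whose vertices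
have to be found inside `P`. -/
lemma restrictsTo_of_exists_decomposition (P : ObjectProperty C) [P.IsTriangulated]
    (h : ∀ M : C, P M → ∃ (X Y : C) (f : X ⟶ M) (g : M ⟶ Y⟦(1 : ℤ)⟧)
      (δ : Y⟦(1 : ℤ)⟧ ⟶ X⟦(1 : ℤ)⟧),
      (P X ∧ w.nonpos X) ∧ (P Y ∧ w.nonneg Y) ∧ Triangle.mk f g δ ∈ distTriang C) :
    w.RestrictsTo P where
  nonpos_retract := ⟨fun r hY => w.nonpos.prop_of_retract (r.map P.ι) hY⟩
  nonneg_retract := ⟨fun r hY => w.nonneg.prop_of_retract (r.map P.ι) hY⟩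
  nonpos_shift X hX := w.nonpos.prop_of_iso ((P.ι.commShiftIso (-1 : ℤ)).symm.app X)
    (w.isWeightStructure.nonpos_shift X.obj hX)
  nonneg_shift X hX := w.nonneg.prop_of_iso ((P.ι.commShiftIso (1 : ℤ)).symm.app X)
    (w.isWeightStructure.nonneg_shift X.obj hX)
  orthogonal X Y hX hY f := by
    apply P.ι.map_injective
    rw [Functor.map_zero, ← cancel_mono ((P.ι.commShiftIso (1 : ℤ)).hom.app Y), zero_comp]
    exact w.isWeightStructure.orthogonal X.obj Y.obj hX hY _
  exists_decomposition M := by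
    obtain ⟨X, Y, f, g, δ, ⟨hX, hX'⟩, ⟨hY, hY'⟩, hT⟩ := h M.obj M.property
    let X' : P.FullSubcategory := ⟨X, hX⟩
    let Y' : P.FullSubcategory := ⟨Y, hY⟩
    let cX : P.ι.obj (X'⟦(1 : ℤ)⟧) ≅ X⟦(1 : ℤ)⟧ := (P.ι.commShiftIso (1 : ℤ)).app X'
    let cY : P.ι.obj (Y'⟦(1 : ℤ)⟧) ≅ Y⟦(1 : ℤ)⟧ := (P.ι.commShiftIso (1 : ℤ)).app Y'
    have hX₁ : P.ι.map (P.fullyFaithfulι.preimage (cY.hom ≫ δ ≫ cX.inv)) ≫ cX.hom =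
        cY.hom ≫ δ := by
      rw [P.fullyFaithfulι.map_preimage]
      simp
    have hY₁ : P.ι.map (P.fullyFaithfulι.preimage (X := M) (g ≫ cY.inv)) ≫ cY.hom = g := by
      rw [P.fullyFaithfulι.map_preimage]
      simp
    refine ⟨X', Y', P.fullyFaithfulι.preimage f, P.fullyFaithfulι.preimage (g ≫ cY.inv),
      P.fullyFaithfulι.preimage (cY.hom ≫ δ ≫ cX.inv), hX', hY', ?_⟩
    have hT' : Triangle.mk (X := X) (Y := M.obj) (Z := P.ι.obj (Y'⟦(1 : ℤ)⟧))
        f (P.ι.map (P.fullyFaithfulι.preimage (X := M) (g ≫ cY.inv)))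
        (P.ι.map (P.fullyFaithfulι.preimage (cY.hom ≫ δ ≫ cX.inv)) ≫ cX.hom) ∈ distTriang C :=
      mk_mem_distTriang_of_iso hT (Iso.refl _) (Iso.refl _) cY (by simp)
        (hY₁.trans (Category.id_comp _).symm) (by rw [hX₁]; simp)
    exact hT'

lemma restrictsTo_of_le_rightDegenerate (P : ObjectProperty C) [P.IsTriangulated]
    (hP : P ≤ w.rightDegenerate) : w.RestrictsTo P := by
  refine w.restrictsTo_of_exists_decomposition P fun M hM => ?_
  -- The decomposition is `M → M → 0`. As `P` need not be closed under isomorphisms, the zero object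
  -- is one chosen in `P`.
  obtain ⟨Z, hZ, hZ'⟩ := P.exists_prop_of_containsZero
  refine ⟨M, Z, 𝟙 M, 0, 0, ⟨hM, w.rightDegenerate_le_nonpos _ (hP _ hM)⟩,
    ⟨hZ', w.nonneg.prop_of_isZero hZ⟩, ?_⟩
  rw [Triangle.distinguished_iff_of_isZero₃ _ ((shiftFunctor C (1 : ℤ)).map_isZero hZ)]
  exact inferInstanceAs (IsIso (𝟙 M))

lemma restrictsTo_of_le_leftDegenerate (P : ObjectProperty C) [P.IsTriangulated]
    (hP : P ≤ w.leftDegenerate) : w.RestrictsTo P := by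
  refine w.restrictsTo_of_exists_decomposition P fun M hM => ?_
  obtain ⟨Z, hZ, hZ'⟩ := P.exists_prop_of_containsZero
  -- The decomposition is `0 → M → M`. Its third vertex must be written as `Y[1]`, hence `Y =
  -- M[-1]`, which is still left degenerate.
  have hM' := P.le_shift (-1 : ℤ) _ hM
  refine ⟨Z, M⟦(-1 : ℤ)⟧, 0, ((shiftEquiv C (1 : ℤ)).counitIso.app M).inv, 0,
    ⟨hZ', w.nonpos.prop_of_isZero hZ⟩, ⟨hM', w.leftDegenerate_le_nonneg _ (hP _ hM')⟩, ?_⟩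
  rw [Triangle.distinguished_iff_of_isZero₁ _ hZ]
  exact inferInstanceAs (IsIso ((shiftEquiv C (1 : ℤ)).counitIso.app M).inv)

lemma restrictsTo_of_le_extensionProduct {P Q D : ObjectProperty C} [D.IsTriangulated]
    (hP : P ≤ w.rightDegenerate) (hQ : Q ≤ w.leftDegenerate) (hPD : P ≤ D) (hQD : Q ≤ D)
    (hD : D ≤ ObjectProperty.extensionProduct P Q) : w.RestrictsTo D := by
  refine w.restrictsTo_of_exists_decomposition D fun M hM => ?_
  obtain ⟨X, Y, f, g, δ, hT, hX, hY⟩ := hD _ hM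
  let e : (Y⟦(-1 : ℤ)⟧)⟦(1 : ℤ)⟧ ≅ Y := (shiftEquiv C (1 : ℤ)).counitIso.app Y
  refine ⟨X, Y⟦(-1 : ℤ)⟧, f, g ≫ e.inv, e.hom ≫ δ,
    ⟨hPD _ hX, w.rightDegenerate_le_nonpos _ (hP _ hX)⟩, ⟨D.le_shift (-1 : ℤ) _ (hQD _ hY),
      w.leftDegenerate_le_nonneg _ (w.leftDegenerate.le_shift (-1 : ℤ) _ (hQ _ hY))⟩, ?_⟩
  exact mk_mem_distTriang_of_iso hT (Iso.refl _) (Iso.refl _) e (by simp) (by simp) (by simp)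

/-- A morphism from `C_{w ≤ 0}` to `C_{w ≥ 0}` factors through the heart. -/
lemma exists_factorization_heart {X Y : C} (hX : w.nonpos X) (hY : w.nonneg Y) (f : X ⟶ Y) :
    ∃ (H : C) (a : X ⟶ H) (b : H ⟶ Y), w.heart H ∧ a ≫ b = f := by
  obtain ⟨H, Y', b, g, δ, hH, hY', hT⟩ := w.isWeightStructure.exists_decomposition Y
  obtain ⟨a, ha⟩ := exists_eq_comp_mor₁ hT f
    (w.isWeightStructure.orthogonal _ _ hX hY' _)
  -- Rotating the decomposition of `Y` exhibits `H` as an extension of `Y` by `Y'`, both in `C_{w ≥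
  -- 0}`.
  refine ⟨H, a, b, ⟨hH, ?_⟩, ha.symm⟩
  exact w.nonneg_obj₂ _ (inv_rot_of_distTriang _ hT) (w.nonneg.prop_of_iso
    ((shiftEquiv C (1 : ℤ)).unitIso.app Y') hY') hY

/-! ### Transport of a weight structure along an exact functor. -/

variable {D : Type u'} [Category.{v'} D] [HasZeroObject D] [Preadditive D]
  [HasShift D ℤ] [∀ n : ℤ, (shiftFunctor D n).Additive] [Pretriangulated D]

/-- Enlarging one class shrinks its orthogonal, so neither class can grow without the other
shrinking. -/
lemma ext_of_le {w₁ w₂ : WeightStructure C} (h₁ : w₁.nonpos ≤ w₂.nonpos)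
    (h₂ : w₁.nonneg ≤ w₂.nonneg) : w₂ = w₁ := by
  ext X
  · refine ⟨fun hX => ?_, h₁ X⟩
    rw [nonpos_iff]
    exact fun Y hY f => w₂.isWeightStructure.orthogonal _ _ hX (h₂ _ hY) f
  · refine ⟨fun hX => ?_, h₂ X⟩
    rw [nonneg_iff]
    exact fun Y hY f => w₂.isWeightStructure.orthogonal _ _ (h₁ _ hY) hX f

/-- The weight structure on the target of an essentially surjective exact functor that is full
on morphisms from `C_{w ≤ 0}` to `C_{w ≥ 0}[1]`. -/
def map (F : C ⥤ D) [F.CommShift ℤ] [F.IsTriangulated] [F.EssSurj]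
    (hF : ∀ X Y : C, w.nonpos X → w.nonneg Y →
      Function.Surjective (fun f : X ⟶ Y⟦(1 : ℤ)⟧ => F.map f)) : WeightStructure D where
  nonpos := (w.nonpos.map F).retractClosure
  nonneg := (w.nonneg.map F).retractClosure
  isWeightStructure :=
    { nonpos_retract := inferInstance
      nonneg_retract := inferInstance
      nonpos_shift := by
        rintro X ⟨X', ⟨Y, hY, ⟨e⟩⟩, ⟨r⟩⟩
        exact ⟨X'⟦(-1 : ℤ)⟧, ⟨Y⟦(-1 : ℤ)⟧, w.isWeightStructure.nonpos_shift _ hY,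
          ⟨(F.commShiftIso (-1 : ℤ)).app Y ≪≫ (shiftFunctor D (-1 : ℤ)).mapIso e⟩⟩,
          ⟨r.map (shiftFunctor D (-1 : ℤ))⟩⟩
      nonneg_shift := by
        rintro X ⟨X', ⟨Y, hY, ⟨e⟩⟩, ⟨r⟩⟩
        exact ⟨X'⟦(1 : ℤ)⟧, ⟨Y⟦(1 : ℤ)⟧, w.isWeightStructure.nonneg_shift _ hY,
          ⟨(F.commShiftIso (1 : ℤ)).app Y ≪≫ (shiftFunctor D (1 : ℤ)).mapIso e⟩⟩,
          ⟨r.map (shiftFunctor D (1 : ℤ))⟩⟩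
      orthogonal := by
        rintro X Y ⟨X', ⟨X₀, hX₀, ⟨eX⟩⟩, ⟨rX⟩⟩ ⟨Y', ⟨Y₀, hY₀, ⟨eY⟩⟩, ⟨rY⟩⟩ f
        let r : Retract X (F.obj X₀) := rX.trans (Retract.ofIso eX.symm)
        let s : Retract (Y⟦(1 : ℤ)⟧) (F.obj (Y₀⟦(1 : ℤ)⟧)) :=
          ((rY.trans (Retract.ofIso eY.symm)).map (shiftFunctor D (1 : ℤ))).trans
            (Retract.ofIso ((F.commShiftIso (1 : ℤ)).app Y₀).symm)
        -- Extended to the ambient images, `f` lifts to a morphism of `C`, which is zero by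
        -- orthogonality there.
        obtain ⟨g, hg : F.map g = r.r ≫ f ≫ s.i⟩ := hF X₀ Y₀ hX₀ hY₀ (r.r ≫ f ≫ s.i)
        rw [w.isWeightStructure.orthogonal _ _ hX₀ hY₀ g, F.map_zero] at hg
        have : f = r.i ≫ (r.r ≫ f ≫ s.i) ≫ s.r := by simp
        rw [this, ← hg, zero_comp, comp_zero]
      exists_decomposition := fun M => by
        obtain ⟨X, Y, f, g, δ, hX, hY, hT⟩ :=
          w.isWeightStructure.exists_decomposition (F.objPreimage M)
        let e := F.objObjPreimageIso M
        let c : F.obj (Y⟦(1 : ℤ)⟧) ≅ (F.obj Y)⟦(1 : ℤ)⟧ := (F.commShiftIso (1 : ℤ)).app Y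
        have hT' : Triangle.mk (F.map f) (F.map g)
            (F.map δ ≫ (F.commShiftIso (1 : ℤ)).hom.app X) ∈ distTriang D :=
          F.map_distinguished _ hT
        refine ⟨F.obj X, F.obj Y, F.map f ≫ e.hom, e.inv ≫ F.map g ≫ c.hom,
          c.inv ≫ F.map δ ≫ (F.commShiftIso (1 : ℤ)).hom.app X,
          ObjectProperty.le_retractClosure _ _ (w.nonpos.prop_map_obj F hX),
          ObjectProperty.le_retractClosure _ _ (w.nonneg.prop_map_obj F hY), ?_⟩
        exact mk_mem_distTriang_of_iso hT' (Iso.refl _) e.symm c.symm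
          (by simp) (by simp) (by simp) }

section

variable (F : C ⥤ D) [F.CommShift ℤ] [F.IsTriangulated] [F.EssSurj]
  (hF : ∀ X Y : C, w.nonpos X → w.nonneg Y →
    Function.Surjective (fun f : X ⟶ Y⟦(1 : ℤ)⟧ => F.map f))

lemma isWeightExact_map : w.IsWeightExact (w.map F hF) F :=
  ⟨fun _ hX => ObjectProperty.le_retractClosure _ _ (w.nonpos.prop_map_obj F hX),
    fun _ hX => ObjectProperty.le_retractClosure _ _ (w.nonneg.prop_map_obj F hX)⟩

lemma eq_map_of_isWeightExact (w' : WeightStructure D) (h : w.IsWeightExact w' F) :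
    w' = w.map F hF := by
  refine ext_of_le ?_ ?_
  · refine (ObjectProperty.retractClosure_le_iff _ _).2 ?_
    rintro X ⟨Y, hY, ⟨e⟩⟩
    exact w'.nonpos.prop_of_iso e (h.1 _ hY)
  · refine (ObjectProperty.retractClosure_le_iff _ _).2 ?_
    rintro X ⟨Y, hY, ⟨e⟩⟩
    exact w'.nonneg.prop_of_iso e (h.2 _ hY)

lemma heart_map
    (hF₀ : ∀ X Y : C, w.nonpos X → w.nonneg Y →
      Function.Surjective (fun f : X ⟶ Y => F.map f)) :
    (w.map F hF).heart = (w.heart.map F).retractClosure := by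
  refine le_antisymm ?_ ?_
  · rintro M ⟨⟨X', ⟨X, hX, ⟨eX⟩⟩, ⟨rX⟩⟩, ⟨Y', ⟨Y, hY, ⟨eY⟩⟩, ⟨rY⟩⟩⟩
    let r : Retract M (F.obj X) := rX.trans (Retract.ofIso eX.symm)
    let s : Retract M (F.obj Y) := rY.trans (Retract.ofIso eY.symm)
    -- The composite `F X → M → F Y` lifts to `C` and factors there through some `H` in the heart;
    -- hence the identity of `M` factors through `F H`.
    obtain ⟨f, hf : F.map f = r.r ≫ s.i⟩ := hF₀ X Y hX hY (r.r ≫ s.i)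
    obtain ⟨H, a, b, hH, rfl⟩ := w.exists_factorization_heart hX hY f
    refine ⟨F.obj H, w.heart.prop_map_obj F hH, ⟨⟨r.i ≫ F.map a, F.map b ≫ s.r, ?_⟩⟩⟩
    rw [Category.assoc, ← Category.assoc (F.map a), ← F.map_comp, hf]
    simp
  · rintro M ⟨X, ⟨H, hH, ⟨e⟩⟩, ⟨r⟩⟩
    exact ⟨⟨X, ⟨H, hH.1, ⟨e⟩⟩, ⟨r⟩⟩, ⟨X, ⟨H, hH.2, ⟨e⟩⟩, ⟨r⟩⟩⟩

end

end WeightStructure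

end

end WeightStr

theorem mainTheorem8 {C : Type u} [Category.{v} C] [HasZeroObject C] [Preadditive C]
    [HasShift C ℤ] [∀ n : ℤ, (shiftFunctor C n).Additive] [Pretriangulated C]
    [CategoryTheory.IsTriangulated C] (w : WeightStructure C) :
    -- (1) degenerate objects
    ((∃ _ : w.rightDegenerate.IsTriangulated, w.RestrictsTo w.rightDegenerate) ∧
      (∃ _ : w.leftDegenerate.IsTriangulated, w.RestrictsTo w.leftDegenerate) ∧
      (∀ (P : ObjectProperty C) [P.IsTriangulated],
        P ≤ w.rightDegenerate ∨ P ≤ w.leftDegenerate → w.RestrictsTo P)) ∧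
    ∀ (Gm Gp : ObjectProperty C), Gm ≤ w.rightDegenerate → Gp ≤ w.leftDegenerate →
      -- (2) restriction to the subcategory generated by `Gm ∪ Gp`
      (w.RestrictsTo (triangulatedClosure (Gm ⊔ Gp)) ∧
        triangulatedClosure (Gm ⊔ Gp) ≤
          ObjectProperty.extensionProduct (triangulatedClosure Gm) (triangulatedClosure Gp)) ∧
      -- (3) the induced weight structure on the Verdier quotient and its heart
      (∃ w' : WeightStructure (VerdierQuotient (triangulatedClosure (Gm ⊔ Gp))),
        w.IsWeightExact w' (verdierFunctor (triangulatedClosure (Gm ⊔ Gp))) ∧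
        (∀ w'' : WeightStructure (VerdierQuotient (triangulatedClosure (Gm ⊔ Gp))),
          w.IsWeightExact w'' (verdierFunctor (triangulatedClosure (Gm ⊔ Gp))) → w'' = w') ∧
        w'.heart =
          (w.heart.map (verdierFunctor (triangulatedClosure (Gm ⊔ Gp)))).retractClosure) ∧
      -- (4) full faithfulness of the localization functor on bounded objects
      (∀ X Y : C, w.bounded X → w.bounded Y →
        Function.Bijective (fun f : X ⟶ Y =>
          (verdierFunctor (triangulatedClosure (Gm ⊔ Gp))).map f)) := by
  refine ⟨⟨⟨inferInstance, w.restrictsTo_of_le_rightDegenerate _ le_rfl⟩,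
    ⟨inferInstance, w.restrictsTo_of_le_leftDegenerate _ le_rfl⟩, fun P _ hP =>
      hP.elim (w.restrictsTo_of_le_rightDegenerate P) (w.restrictsTo_of_le_leftDegenerate P)⟩,
    fun Gm Gp hGm hGp => ?_⟩
  have hm : triangulatedClosure Gm ≤ w.rightDegenerate := triangulatedClosure_le hGm
  have hp : triangulatedClosure Gp ≤ w.leftDegenerate := triangulatedClosure_le hGp
  have hmD : triangulatedClosure Gm ≤ triangulatedClosure (Gm ⊔ Gp) :=
    triangulatedClosure_le (le_sup_left.trans (le_triangulatedClosure _))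
  have hpD : triangulatedClosure Gp ≤ triangulatedClosure (Gm ⊔ Gp) :=
    triangulatedClosure_le (le_sup_right.trans (le_triangulatedClosure _))
  have hD : triangulatedClosure (Gm ⊔ Gp) ≤
      ObjectProperty.extensionProduct (triangulatedClosure Gm) (triangulatedClosure Gp) :=
    triangulatedClosure_sup_le_extensionProduct fun X hX Y f hY =>
      w.rightDegenerate_le_leftOrthogonal X (hm _ hX) f (hp _ hY)
  -- An upper bound on `X` and a lower bound on `Y` suffice, with no relation between `i` and `j`.
  -- The case `i = j = 0` gives the weight structure and its heart; arbitrary bounds give full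
  -- faithfulness.
  have bij {X Y : C} {i j : ℤ} (hX : w.le i X) (hY : w.ge j Y) :
      Function.Bijective (fun f : X ⟶ Y =>
        (verdierFunctor (triangulatedClosure (Gm ⊔ Gp))).map f) :=
    bijective_map_of_le_extensionProduct hmD hD
      (fun Z f hZ => w.le_le_leftOrthogonal i X hX f (hp _ hZ))
      (fun Z f hZ => w.ge_le_rightOrthogonal j Y hY f (hm _ hZ)) _
  have surj₀ (X Y : C) (hX : w.nonpos X) (hY : w.nonneg Y) :
      Function.Surjective (fun f : X ⟶ Y =>
        (verdierFunctor (triangulatedClosure (Gm ⊔ Gp))).map f) :=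
    (bij (w.le_zero.symm ▸ hX) (w.ge_zero.symm ▸ hY)).2
  have surj₁ (X Y : C) (hX : w.nonpos X) (hY : w.nonneg Y) :
      Function.Surjective (fun f : X ⟶ Y⟦(1 : ℤ)⟧ =>
        (verdierFunctor (triangulatedClosure (Gm ⊔ Gp))).map f) :=
    surj₀ X _ hX (w.isWeightStructure.nonneg_shift Y hY)
  have := Localization.essSurj (verdierFunctor (triangulatedClosure (Gm ⊔ Gp)))
    (triangulatedClosure (Gm ⊔ Gp)).trW
  refine ⟨⟨w.restrictsTo_of_le_extensionProduct hm hp hmD hpD hD, hD⟩,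
    ⟨w.map _ surj₁, w.isWeightExact_map _ surj₁, w.eq_map_of_isWeightExact _ surj₁,
      w.heart_map _ surj₁ surj₀⟩, ?_⟩
  rintro X Y ⟨_, _, -, hX⟩ ⟨_, _, hY, -⟩
  exact bij hX hY
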